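/- **Setting.** Let $h:\mathbb{R}^n\to\mathbb{R}$ be a Legendre function with full domain (convex, differentiable and strictly convex on $\mathbb{R}^n$), let $h^*(u)=\sup_x\langle u,x\rangle-h(x)$ be its convex conjugate, let $h_-:=h(-\,\cdot\,)$, and for $\lambda>0$ write $(\lambda\star h)(x)=\lambda h(\lambda^{-1}x)$. Let $L>0$ and let $f:\mathbb{R}^n\to\mathbb{R}$ be such that $p:=-f$ is anisotropically smooth relative to $h$ with constant $L$, that is, $p$ is continuously differentiable, $\operatorname{ran}\nabla p\subseteq\operatorname{ran}\nabla h$, and for all $x,\bar x\in\mathbb{R}^n$ $$p(x)\le p(\bar x)+\tfrac1L\star h\bigl(x-\bar x+\tfrac1L\nabla h^*(\nabla p(\bar x))\bigr)-\tfrac1L\star h\bigl(\tfrac1L\nabla h^*(\nabla p(\bar x))\bigr).$$ Let $g:\mathbb{R}^n\to\overline{\mathbb{R}}$ be proper and lower semicontinuous and such that $g+\tfrac1L\star h(\cdot-y)$ is level-bounded for every $y\in\mathbb{R}^n$. Put $F=g-f$ and $\Phi(x,y)=-\tfrac1L\star h(x-y)$. For $\psi:\mathbb{R}^n\to\overline{\mathbb{R}}$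 let $\psi^\Phi(y)=\sup_x\Phi(x,y)-\psi(x)$, let $\partial_\Phi\psi(\bar x)$ be the set of all $y$ with $\psi(x)\ge\psi(\bar x)+\Phi(x,y)-\Phi(\bar x,y)$ for all $x$, and define the primal and dual gaps $$\operatorname{gap}_g^\Phi(x,y)=g(x)+g^\Phi(y)-\Phi(x,y),\qquad \operatorname{gap}_f^\Phi(y,x)=f(x)+f^\Phi(y)-\Phi(x,y).$$ A proper lsc convex function $\psi$ is called anisotropically strongly convex relative to a full-domain Legendre function $k$ with constant $\eta>0$ if $\operatorname{ran}\partial\psi\supseteq\operatorname{ran}\nabla k$ and, for all $\bar x$, all $\bar u\in\partial\psi(\bar x)\cap\operatorname{int}\operatorname{dom}k^*$ and all $x\in\mathbb{R}^n$, $$\psi(x)\ge\psi(\bar x)+\tfrac1\eta\star k\bigl(x-\bar x+\tfrac1\eta\nabla k^*(\bar u)\bigr)-\tfrac1\eta\star k\bigl(\tfrac1\eta\nabla k^*(\bar u)\bigr).$$ **Lemma.** (i) Let $\bar x\in\mathbb{R}^n$, $\bar y=\bar x-\tfrac1L\nabla h^*(-\nabla f(\bar x))$ and $x^+\in\operatorname{argmin}_{x}\,g(x)+\tfrac1L\star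 h(x-\bar y)$. Then $$\operatorname{gap}_g^\Phi(\bar x,\bar y)=g(\bar x)-\min_{x\in\mathbb{R}^n}\bigl\{g(x)+\tfrac1L\star h(x-\bar y)\bigr\}+\tfrac1L\star h\bigl(\tfrac1L\nabla h^*(-\nabla f(\bar x))\bigr),$$ $$\operatorname{gap}_f^\Phi(\bar y,x^+)=-f(\bar x)+f(x^+)+\tfrac1L\star h(x^+-\bar y)-\tfrac1L\star h\bigl(\tfrac1L\nabla h^*(-\nabla f(\bar x))\bigr).$$ (ii) Suppose that $-f$ is anisotropically strongly convex relative to $h$ with constant $\eta_f>0$ and $g$ is anisotropically strongly convex relative to $h_-$ with constant $\eta_g>0$ (if $h$ is even, then $h_-=h$). Then $F$ satisfies the $\Phi$-DCA-PL inequality with $\mu_1=\eta_f/L$ and $\mu_2=\eta_g/L$: $\mu_1+\mu_2>0$, and for all $\bar x\in\operatorname{dom}F$, $\bar y\in\partial_\Phi f(\bar x)$ and $x^+\in\operatorname{argmin}_x\,g(x)-\Phi(x,\bar y)$, $$\operatorname{gap}_g^\Phi(\bar x,\bar y)+\operatorname{gap}_f^\Phi(\bar y,x^+)\ \ge\ \mu_1\bigl(F(\bar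 x)-\inf F\bigr)+\mu_2\bigl(F(x^+)-\inf F\bigr).$$ Consequently, for all sequences with $y^k\in\partial_\Phi f(x^k)$ and $y^k\in\partial_\Phi g(x^{k+1})$, $k\ge0$, the values $F(x^k)$ converge $q$-linearly: whenever $x^k\in\operatorname{dom}F$, $$F(x^{k+1})-\inf F\ \le\ \frac{1-\eta_f/L}{1+\eta_g/L}\,\bigl(F(x^k)-\inf F\bigr),\qquad \frac{1-\eta_f/L}{1+\eta_g/L}<1.$$ -/

import Mathlib

open Set

noncomputable section

/-! ### Generalized convexity for a real-valued coupling -/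

/-- The `Φ`-conjugate `f^Φ(y) = sup_x Φ(x, y) - f(x)`. -/
def phiConj {X Y : Type*} (Φ : X → Y → ℝ) (f : X → EReal) (y : Y) : EReal :=
  ⨆ x, ((Φ x y : ℝ) : EReal) - f x

/-- The `Φ`-subdifferential of `f` at `xbar`. -/
def phiSubdiff {X Y : Type*} (Φ : X → Y → ℝ) (f : X → EReal) (xbar : X) : Set Y :=
  {y | ∀ x, f xbar + ((Φ x y - Φ xbar y : ℝ) : EReal) ≤ f x}

/-- The regularized gap function `g(x) + g^Φ(y) - Φ(x, y)`. The primal gap is `phiGap Φ g x y`;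
the dual gap, written with the arguments in the order `(y, x)` on paper, is `phiGap Φ f x y`. -/
def phiGap {X Y : Type*} (Φ : X → Y → ℝ) (g : X → EReal) (x : X) (y : Y) : EReal :=
  g x + phiConj Φ g y - ((Φ x y : ℝ) : EReal)

open Classical in
/-- The objective `F = g - f`, with the convention `∞ - ∞ = ∞`. -/
def dcObjective {X : Type*} (g f : X → EReal) (x : X) : EReal :=
  if g x = ⊤ then ⊤ else g x - f x

/-- The set of global minimizers of `φ`. -/
def argminSet {X : Type*} (φ : X → EReal) : Set X :=
  {x | ∀ z, φ x ≤ φ z}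

/-- The `Φ`-DCA-PL inequality for `F = g - f` with constants `μ₁`, `μ₂`. -/
def PhiDCAPL {X Y : Type*} (Φ : X → Y → ℝ) (g f : X → EReal) (μ₁ μ₂ : ℝ) : Prop :=
  0 < μ₁ + μ₂ ∧
    ∀ xbar, dcObjective g f xbar < ⊤ →
      ∀ ybar ∈ phiSubdiff Φ f xbar,
        ∀ xplus ∈ argminSet (fun x => g x - ((Φ x ybar : ℝ) : EReal)),
          (μ₁ : EReal) * (dcObjective g f xbar - ⨅ z, dcObjective g f z)
              + (μ₂ : EReal) * (dcObjective g f xplus - ⨅ z, dcObjective g f z)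
            ≤ phiGap Φ g xbar ybar + phiGap Φ f xplus ybar

/-- `(x, y)` are iterates of the `Φ`-DCA: `y^k ∈ ∂_Φ f(x^k)` and `x^{k+1} ∈ (∂_Φ g)⁻¹(y^k)`. -/
def IsPhiDCA {X Y : Type*} (Φ : X → Y → ℝ) (g f : X → EReal) (x : ℕ → X) (y : ℕ → Y) : Prop :=
  ∀ k, y k ∈ phiSubdiff Φ f (x k) ∧ y k ∈ phiSubdiff Φ g (x (k + 1))

/-! ### Extended real-valued functions on Euclidean space -/

/-- Proper: not identically `+∞` and nowhere `-∞`. -/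
def IsProperFun {X : Type*} (ψ : X → EReal) : Prop :=
  (∃ x, ψ x < ⊤) ∧ ∀ x, ⊥ < ψ x

/-- All real sublevel sets are bounded. -/
def IsLevelBounded {n : ℕ} (ψ : EuclideanSpace ℝ (Fin n) → EReal) : Prop :=
  ∀ α : ℝ, Bornology.IsBounded {x | ψ x ≤ (α : EReal)}

/-- The class `Γ₀` of proper, lsc, convex functions; convexity means convexity of the epigraph. -/
def IsGammaZero {n : ℕ} (ψ : EuclideanSpace ℝ (Fin n) → EReal) : Prop :=
  IsProperFun ψ ∧ LowerSemicontinuous ψ ∧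
    Convex ℝ {p : EuclideanSpace ℝ (Fin n) × ℝ | ψ p.1 ≤ ((p.2 : ℝ) : EReal)}

/-- The subdifferential of convex analysis. -/
def convexSubdiff {n : ℕ} (ψ : EuclideanSpace ℝ (Fin n) → EReal)
    (xbar : EuclideanSpace ℝ (Fin n)) : Set (EuclideanSpace ℝ (Fin n)) :=
  {u | ∀ x, ψ xbar + ((inner ℝ u (x - xbar) : ℝ) : EReal) ≤ ψ x}

/-! ### The reference function -/

/-- Legendre type functions with full domain. As the domain has no boundary, essential smoothness
is convexity with differentiability everywhere; since the subdifferential is nonempty everywhere,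
essential strict convexity is strict convexity on the whole space. -/
structure IsFullLegendre {n : ℕ} (h : EuclideanSpace ℝ (Fin n) → ℝ) : Prop where
  differentiable : Differentiable ℝ h
  strictConvex : StrictConvexOn ℝ univ h

/-- The convex conjugate `h*(u) = sup_x ⟨u, x⟩ - h(x)`. -/
def fenchelConj {n : ℕ} (h : EuclideanSpace ℝ (Fin n) → ℝ)
    (u : EuclideanSpace ℝ (Fin n)) : EReal :=
  ⨆ x, ((inner ℝ u x - h x : ℝ) : EReal)

/-- The effective domain of `h*`. -/
def fenchelDom {n : ℕ} (h : EuclideanSpace ℝ (Fin n) → ℝ) : Set (EuclideanSpace ℝ (Fin n)) :=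
  {u | fenchelConj h u < ⊤}

/-- `∇h*(u)`, meaningful for `u` in the interior of the domain of `h*`, where `h*` is finite. -/
def gradConj {n : ℕ} (h : EuclideanSpace ℝ (Fin n) → ℝ)
    (u : EuclideanSpace ℝ (Fin n)) : EuclideanSpace ℝ (Fin n) :=
  gradient (fun v => (fenchelConj h v).toReal) u

/-- The epi-scaling `(lam ⋆ h)(x) = lam h(lam⁻¹ x)`, for `lam > 0`. -/
def epiScale {n : ℕ} (lam : ℝ) (h : EuclideanSpace ℝ (Fin n) → ℝ)
    (x : EuclideanSpace ℝ (Fin n)) : ℝ :=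
  lam * h (lam⁻¹ • x)

/-- The coupling `Φ(x, y) = -((1/L) ⋆ h)(x - y)`. -/
def anisoCoupling {n : ℕ} (h : EuclideanSpace ℝ (Fin n) → ℝ) (L : ℝ)
    (x y : EuclideanSpace ℝ (Fin n)) : ℝ :=
  -epiScale (1 / L) h (x - y)

/-- `p` is anisotropically smooth relative to `h` with constant `L`: it is continuously
differentiable, its gradients lie in the range of `∇h` (so that `∇h*(∇p(xbar))` is defined), and
the anisotropic descent inequality holds. -/
structure AnisoSmooth {n : ℕ} (h : EuclideanSpace ℝ (Fin n) → ℝ) (L : ℝ)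
    (p : EuclideanSpace ℝ (Fin n) → ℝ) : Prop where
  contDiff : ContDiff ℝ 1 p
  range_subset : range (gradient p) ⊆ range (gradient h)
  descent : ∀ xbar x,
    p x ≤ p xbar + epiScale (1 / L) h (x - xbar + L⁻¹ • gradConj h (gradient p xbar))
      - epiScale (1 / L) h (L⁻¹ • gradConj h (gradient p xbar))

/-- `ψ` is anisotropically strongly convex relative to `h` with constant `η`. -/
structure AnisoStronglyConvex {n : ℕ} (h : EuclideanSpace ℝ (Fin n) → ℝ) (η : ℝ)
    (ψ : EuclideanSpace ℝ (Fin n) → EReal) : Prop where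
  gammaZero : IsGammaZero ψ
  range_subset : range (gradient h) ⊆ {u | ∃ x, u ∈ convexSubdiff ψ x}
  lower_bound : ∀ xbar, ∀ ubar ∈ convexSubdiff ψ xbar, ubar ∈ interior (fenchelDom h) → ∀ x,
    ψ xbar + ((epiScale (1 / η) h (x - xbar + η⁻¹ • gradConj h ubar)
        - epiScale (1 / η) h (η⁻¹ • gradConj h ubar) : ℝ) : EReal) ≤ ψ x

/-- The reflection `h(-·)`; it equals `h` when `h` is even. -/
def reflect {n : ℕ} (h : EuclideanSpace ℝ (Fin n) → ℝ) : EuclideanSpace ℝ (Fin n) → ℝ :=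
  fun x => h (-x)

end

/-! ### Convex analysis -/

/-! Part (i) is Fenchel-Young equality: `AnisoSmooth.mem_phiSubdiff` and optimality of `xplus` place
`ybar` in both Φ-subdifferentials, so both conjugates are explicit.

For (ii), fix a step `x → x'` with dual point `y` and a competitor `z`. Strong convexity bounds a
difference of values of `h` whose argument moves by `η`, while the coupling moves it by `L`; a step
of relative length `t = η / L` makes the two match. In `primal_gap_ge` the Φ-subgradient inequality
of `g` is tested at `x + t(z - x)`: convexity bounds `g` there, and strong convexity of `-f` bounds
the coupling term. In `dual_gap_ge` the Φ-subgradient inequality of `f` is tested at the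
extrapolated point `x' - t(z - x')`: here `-f` supplies convexity and `g` strong convexity, relative
to the reflected `h` because optimality of `x'` gives the subgradient `-∇h`. Reading the strong
convexity bounds in terms of `h` requires `∇h*(∇h(w)) = w` (`IsFullLegendre.gradConj_gradient`).

Taking the infimum over `z` yields the PL inequality. The two gaps sum to `F(x) - F(x')`, and the
linear rate follows. -/

/-- Evaluating a function with convex epigraph on a segment. -/
lemma le_of_convex_epigraph {n : ℕ} {ψ : EuclideanSpace ℝ (Fin n) → EReal}
    (hψ : Convex ℝ {p : EuclideanSpace ℝ (Fin n) × ℝ | ψ p.1 ≤ ((p.2 : ℝ) : EReal)})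
    {x z : EuclideanSpace ℝ (Fin n)} {a c : ℝ} (hx : ψ x = a) (hz : ψ z = c)
    {s : ℝ} (hs0 : 0 ≤ s) (hs1 : s ≤ 1) :
    ψ (x + s • (z - x)) ≤ ((a + s * (c - a) : ℝ) : EReal) := by
  have h1 : (x, a) ∈ {p : EuclideanSpace ℝ (Fin n) × ℝ | ψ p.1 ≤ ((p.2 : ℝ) : EReal)} := hx.le
  have h2 : (z, c) ∈ {p : EuclideanSpace ℝ (Fin n) × ℝ | ψ p.1 ≤ ((p.2 : ℝ) : EReal)} := hz.le
  have h3 := hψ h1 h2 (sub_nonneg.2 hs1) hs0 (by ring)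
  have e1 : x + s • (z - x) = (1 - s) • x + s • z := by module
  have e2 : a + s * (c - a) = (1 - s) * a + s * c := by ring
  rw [e1, e2]
  simpa using h3

lemma hasDerivAt_comp_line {n : ℕ} {q : EuclideanSpace ℝ (Fin n) → ℝ}
    {v x : EuclideanSpace ℝ (Fin n)} (hq : HasGradientAt q v x) (d : EuclideanSpace ℝ (Fin n)) :
    HasDerivAt (fun s : ℝ => q (x + s • d)) (inner ℝ v d) 0 := by
  have h1 : HasDerivAt (fun s : ℝ => x + s • d) d 0 := by
    simpa using ((hasDerivAt_id (0 : ℝ)).smul_const d).const_add x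
  have h2 : HasFDerivAt q (InnerProductSpace.toDual ℝ _ v) (x + (0 : ℝ) • d) := by
    simpa using hq.hasFDerivAt
  exact (h2.comp_hasDerivAt (0 : ℝ) h1).congr_deriv (by simp)

/-- Fermat's rule for the sum of a convex and a differentiable function. -/
lemma neg_mem_convexSubdiff_of_forall_add_le {n : ℕ} {ψ : EuclideanSpace ℝ (Fin n) → EReal}
    (hψ : Convex ℝ {p : EuclideanSpace ℝ (Fin n) × ℝ | ψ p.1 ≤ ((p.2 : ℝ) : EReal)})
    (hbot : ∀ x, ⊥ < ψ x)
    {q : EuclideanSpace ℝ (Fin n) → ℝ} {v x : EuclideanSpace ℝ (Fin n)}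
    (hq : HasGradientAt q v x) {a : ℝ} (hx : ψ x = a)
    (hmin : ∀ z, ψ x + (q x : EReal) ≤ ψ z + (q z : EReal)) :
    -v ∈ convexSubdiff ψ x := by
  intro z
  by_cases htop : ψ z = ⊤
  · simp [htop]
  obtain ⟨c, hc⟩ : ∃ c : ℝ, ψ z = c := ⟨_, (EReal.coe_toReal htop (hbot z).ne').symm⟩
  -- By minimality and convexity of `ψ`, every difference quotient of `q` along the segment is at
  -- least `a - c`; let the step tend to zero.
  have key : a - c ≤ inner ℝ v (z - x) := by
    have hd := (hasDerivAt_comp_line hq (z - x)).tendsto_slope_zero_right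
    refine ge_of_tendsto hd ?_
    filter_upwards [Ioo_mem_nhdsGT (zero_lt_one (α := ℝ))] with s hs
    have h1 := le_of_convex_epigraph hψ hx hc hs.1.le hs.2.le
    have h2 := (hmin (x + s • (z - x))).trans (add_le_add_left h1 _)
    rw [hx] at h2
    norm_cast at h2
    simp only [zero_add, zero_smul, add_zero, smul_eq_mul]
    rw [inv_mul_eq_div, le_div_iff₀ hs.1]
    nlinarith
  rw [hx, hc, inner_neg_left]
  norm_cast
  linarith

lemma convex_epigraph_of_convexOn {n : ℕ} {φ : EuclideanSpace ℝ (Fin n) → ℝ}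
    (hφ : ConvexOn ℝ univ φ) :
    Convex ℝ {p : EuclideanSpace ℝ (Fin n) × ℝ | ((φ p.1 : ℝ) : EReal) ≤ ((p.2 : ℝ) : EReal)} := by
  simpa using hφ.convex_epigraph

/-- Fermat's rule applied to `φ + (-φ) = 0`, which every point minimizes. -/
lemma gradient_mem_convexSubdiff {n : ℕ} {φ : EuclideanSpace ℝ (Fin n) → ℝ}
    (hφ : Convex ℝ
      {p : EuclideanSpace ℝ (Fin n) × ℝ | ((φ p.1 : ℝ) : EReal) ≤ ((p.2 : ℝ) : EReal)})
    {v x : EuclideanSpace ℝ (Fin n)} (hv : HasGradientAt φ v x) :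
    v ∈ convexSubdiff (fun x => ((φ x : ℝ) : EReal)) x := by
  have hneg : HasGradientAt (fun x => -φ x) (-v) x := by
    rw [hasGradientAt_iff_hasFDerivAt, map_neg]
    exact hv.hasFDerivAt.neg
  have := neg_mem_convexSubdiff_of_forall_add_le hφ (fun x => EReal.bot_lt_coe _) hneg rfl
    (fun z => by norm_cast; simp)
  simpa using this

/-! ### Legendre functions and the gradient of the conjugate. -/

lemma IsFullLegendre.gradient_inequality {n : ℕ} {h : EuclideanSpace ℝ (Fin n) → ℝ}
    (hh : IsFullLegendre h) (z x : EuclideanSpace ℝ (Fin n)) :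
    h z + inner ℝ (gradient h z) (x - z) ≤ h x := by
  have := gradient_mem_convexSubdiff (convex_epigraph_of_convexOn hh.strictConvex.convexOn)
    (hh.differentiable z).hasGradientAt x
  beta_reduce at this
  exact_mod_cast this

/-- The remainder of the linearization of a full-domain Legendre function grows at least linearly
away from the base point. -/
lemma IsFullLegendre.exists_linear_growth {n : ℕ} {h : EuclideanSpace ℝ (Fin n) → ℝ}
    (hh : IsFullLegendre h) (z : EuclideanSpace ℝ (Fin n)) {ε : ℝ} (hε : 0 < ε) :
    ∃ m > 0, ∀ x, ε ≤ ‖x - z‖ →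
      m * ‖x - z‖ ≤ h x - h z - inner ℝ (gradient h z) (x - z) := by
  set δ : EuclideanSpace ℝ (Fin n) → ℝ := fun x => h x - h z - inner ℝ (gradient h z) (x - z)
    with hδ
  have hδc : Continuous δ := by
    have := hh.differentiable.continuous
    fun_prop
  have hpos : ∀ x, x ≠ z → 0 < δ x := by
    intro x hx
    have h1 := hh.strictConvex.2 (mem_univ x) (mem_univ z) hx
      (one_half_pos (α := ℝ)) (one_half_pos (α := ℝ)) (add_halves 1)
    have h2 := hh.gradient_inequality z ((1 / 2 : ℝ) • x + (1 / 2 : ℝ) • z)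
    have e : (1 / 2 : ℝ) • x + (1 / 2 : ℝ) • z - z = (1 / 2 : ℝ) • (x - z) := by module
    rw [e, inner_smul_right] at h2
    simp only [smul_eq_mul] at h1
    simp only [hδ]
    linarith
  -- By convexity `δ x / ‖x - z‖` is nondecreasing along rays from `z`, so its minimum over the
  -- sphere of radius `ε` is a valid slope.
  have hscale : ∀ x, ε ≤ ‖x - z‖ →
      ∃ y ∈ Metric.sphere z ε, δ y ≤ (ε / ‖x - z‖) * δ x := by
    intro x hx
    have hn : 0 < ‖x - z‖ := hε.trans_le hx
    set s := ε / ‖x - z‖ with hs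
    have hs0 : 0 < s := by positivity
    have hs1 : s ≤ 1 := (div_le_one hn).2 hx
    refine ⟨z + s • (x - z), ?_, ?_⟩
    · rw [mem_sphere_iff_norm, add_sub_cancel_left, norm_smul, Real.norm_of_nonneg hs0.le, hs]
      field_simp
    · have h1 := hh.strictConvex.convexOn.2 (mem_univ z) (mem_univ x) (sub_nonneg.2 hs1) hs0.le
        (by ring)
      have e : (1 - s) • z + s • x = z + s • (x - z) := by module
      rw [e] at h1
      simp only [smul_eq_mul] at h1
      simp only [hδ, add_sub_cancel_left, inner_smul_right]
      linarith
  -- The sphere is empty when `n = 0`; the claim is then vacuous.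
  rcases (Metric.sphere z ε).eq_empty_or_nonempty with he | hne
  · refine ⟨1, one_pos, fun x hx => ?_⟩
    obtain ⟨y, hy, -⟩ := hscale x hx
    simp [he] at hy
  · obtain ⟨y₀, hy₀, hmin⟩ := (isCompact_sphere z ε).exists_isMinOn hne hδc.continuousOn
    have hy₀z : y₀ ≠ z := by
      rintro rfl
      simp [hε.ne] at hy₀
    refine ⟨δ y₀ / ε, div_pos (hpos y₀ hy₀z) hε, fun x hx => ?_⟩
    obtain ⟨y, hy, hyx⟩ := hscale x hx
    have hn : 0 < ‖x - z‖ := hε.trans_le hx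
    have h1 : δ y₀ ≤ ε / ‖x - z‖ * δ x := (hmin hy).trans hyx
    rw [div_mul_eq_mul_div, le_div_iff₀ hn] at h1
    rw [div_mul_eq_mul_div, div_le_iff₀ hε]
    linarith

lemma coe_le_fenchelConj {n : ℕ} (h : EuclideanSpace ℝ (Fin n) → ℝ)
    (v z : EuclideanSpace ℝ (Fin n)) :
    ((inner ℝ v z - h z : ℝ) : EReal) ≤ fenchelConj h v :=
  le_iSup (fun x => ((inner ℝ v x - h x : ℝ) : EReal)) z

/-- Upper bound for the conjugate near a gradient. -/
lemma IsFullLegendre.fenchelConj_le {n : ℕ} {h : EuclideanSpace ℝ (Fin n) → ℝ}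
    (hh : IsFullLegendre h) (z : EuclideanSpace ℝ (Fin n)) {ε : ℝ} (hε : 0 < ε) :
    ∃ m > 0, ∀ v, ‖v - gradient h z‖ ≤ m →
      fenchelConj h v ≤ ((inner ℝ v z - h z + ε * ‖v - gradient h z‖ : ℝ) : EReal) := by
  obtain ⟨m, hm, hgrow⟩ := hh.exists_linear_growth z hε
  refine ⟨m, hm, fun v hv => iSup_le fun x => ?_⟩
  norm_cast
  have hcs : inner ℝ (v - gradient h z) (x - z) ≤ ‖v - gradient h z‖ * ‖x - z‖ :=
    real_inner_le_norm _ _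
  have e : (inner ℝ v x : ℝ)
      = inner ℝ v z + inner ℝ (v - gradient h z) (x - z) + inner ℝ (gradient h z) (x - z) := by
    simp only [inner_sub_left, inner_sub_right]
    ring
  have hn := norm_nonneg (v - gradient h z)
  -- Far from `z` the linear growth absorbs the perturbation of slope at most `m`; near `z` the
  -- perturbation is at most `ε * ‖v - gradient h z‖`.
  rcases le_or_gt ε ‖x - z‖ with hx | hx
  · have h1 := hgrow x hx
    have h2 := mul_le_mul_of_nonneg_right hv (norm_nonneg (x - z))
    have h3 := mul_nonneg hε.le hn
    linarith
  · have h1 := hh.gradient_inequality z x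
    have h2 := mul_le_mul_of_nonneg_left hx.le hn
    linarith

/-- The range of the gradient lies in the interior of the domain of the conjugate. -/
lemma IsFullLegendre.gradient_mem_interior {n : ℕ} {h : EuclideanSpace ℝ (Fin n) → ℝ}
    (hh : IsFullLegendre h) (z : EuclideanSpace ℝ (Fin n)) :
    gradient h z ∈ interior (fenchelDom h) := by
  obtain ⟨m, hm, hle⟩ := hh.fenchelConj_le z one_pos
  refine mem_interior_iff_mem_nhds.2 (Filter.mem_of_superset (Metric.ball_mem_nhds _ hm) ?_)
  intro v hv
  exact (hle v (mem_ball_iff_norm.1 hv).le).trans_lt (EReal.coe_lt_top _)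

/-- `∇h*` inverts `∇h`. -/
lemma IsFullLegendre.gradConj_gradient {n : ℕ} {h : EuclideanSpace ℝ (Fin n) → ℝ}
    (hh : IsFullLegendre h) (z : EuclideanSpace ℝ (Fin n)) :
    gradConj h (gradient h z) = z := by
  -- The conjugate lies between an affine function of slope `z` and the same function plus an
  -- arbitrarily small multiple of the distance, which is differentiability with gradient `z`.
  have hbound : ∀ ε > 0, ∃ m > 0, ∀ v, ‖v - gradient h z‖ ≤ m →
      (inner ℝ v z - h z ≤ (fenchelConj h v).toReal ∧
        (fenchelConj h v).toReal ≤ inner ℝ v z - h z + ε * ‖v - gradient h z‖) := by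
    intro ε hε
    obtain ⟨m, hm, hle⟩ := hh.fenchelConj_le z hε
    refine ⟨m, hm, fun v hv => ?_⟩
    have h1 := hle v hv
    have h2 := coe_le_fenchelConj h v z
    have hr : ((fenchelConj h v).toReal : EReal) = fenchelConj h v :=
      EReal.coe_toReal (h1.trans_lt (EReal.coe_lt_top _)).ne
        ((EReal.bot_lt_coe _).trans_le h2).ne'
    rw [← hr] at h1 h2
    exact ⟨by exact_mod_cast h2, by exact_mod_cast h1⟩
  have h0 : (fenchelConj h (gradient h z)).toReal = inner ℝ (gradient h z) z - h z := by
    obtain ⟨m, hm, hb⟩ := hbound 1 one_pos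
    have := hb (gradient h z) (by simpa using hm.le)
    simp only [sub_self, norm_zero, mul_zero, add_zero] at this
    exact le_antisymm this.2 this.1
  refine HasGradientAt.gradient ?_
  rw [hasGradientAt_iff_isLittleO, Asymptotics.isLittleO_iff]
  intro ε hε
  obtain ⟨m, hm, hb⟩ := hbound ε hε
  filter_upwards [Metric.closedBall_mem_nhds _ hm] with v hv
  have h1 := hb v (mem_closedBall_iff_norm.1 hv)
  rw [h0, inner_sub_right, real_inner_comm v z, real_inner_comm (gradient h z) z,
    Real.norm_eq_abs, abs_le]
  have := mul_nonneg hε.le (norm_nonneg (v - gradient h z))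
  constructor <;> linarith [h1.1, h1.2]

/-! ### Reflection and epi-scaling of the reference function. -/

lemma gradient_reflect {n : ℕ} {h : EuclideanSpace ℝ (Fin n) → ℝ}
    (hh : Differentiable ℝ h) (z : EuclideanSpace ℝ (Fin n)) :
    gradient (reflect h) (-z) = -gradient h z := by
  refine HasGradientAt.gradient ?_
  have h1 : HasFDerivAt h (InnerProductSpace.toDual ℝ _ (gradient h z)) (-(-z)) := by
    rw [neg_neg]
    exact (hh z).hasGradientAt.hasFDerivAt
  rw [hasGradientAt_iff_hasFDerivAt]
  refine (h1.comp (-z) (hasFDerivAt_id (-z)).neg).congr_fderiv ?_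
  ext d
  simp

lemma IsFullLegendre.reflect {n : ℕ} {h : EuclideanSpace ℝ (Fin n) → ℝ}
    (hh : IsFullLegendre h) : IsFullLegendre (reflect h) := by
  refine ⟨hh.differentiable.comp differentiable_id.neg, convex_univ, ?_⟩
  intro x _ y _ hxy a b ha hb hab
  have := hh.strictConvex.2 (mem_univ (-x)) (mem_univ (-y)) (neg_injective.ne hxy) ha hb hab
  have e : a • -x + b • -y = -(a • x + b • y) := by module
  rw [e] at this
  exact this

lemma hasGradientAt_epiScale_sub {n : ℕ} {h : EuclideanSpace ℝ (Fin n) → ℝ}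
    (hh : Differentiable ℝ h) {L : ℝ} (hL : 0 < L) (x y : EuclideanSpace ℝ (Fin n)) :
    HasGradientAt (fun x => epiScale (1 / L) h (x - y)) (gradient h (L • (x - y))) x := by
  rw [hasGradientAt_iff_hasFDerivAt]
  have h1 := (hh (L • (x - y))).hasGradientAt.hasFDerivAt
  have h2 := ((h1.comp x (((hasFDerivAt_id x).sub_const y).const_smul L))).const_mul (1 / L)
  have e : (fun x => epiScale (1 / L) h (x - y))
      = fun x => 1 / L * (h ∘ (L • fun x => id x - y)) x := by
    funext x
    simp [epiScale]
  rw [e]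
  refine h2.congr_fderiv ?_
  ext d
  have hL0 : L ≠ 0 := hL.ne'
  simp [hL0]

/-! ### Conjugates and gaps -/

lemma IsProperFun.exists_coe_eq {X : Type*} {ψ : X → EReal} (hψ : IsProperFun ψ) {x : X}
    (hx : ψ x ≠ ⊤) : ∃ a : ℝ, ψ x = a :=
  ⟨_, (EReal.coe_toReal hx (hψ.2 x).ne').symm⟩

lemma exists_coe_eq_of_mem_phiSubdiff {X Y : Type*} {Φ : X → Y → ℝ} {ψ : X → EReal}
    (hψ : IsProperFun ψ) {x : X} {y : Y} (hy : y ∈ phiSubdiff Φ ψ x) : ∃ a : ℝ, ψ x = a := by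
  refine hψ.exists_coe_eq fun htop => ?_
  obtain ⟨z, hz⟩ := hψ.1
  have := hy z
  rw [htop, EReal.top_add_coe] at this
  exact absurd (this.trans_lt hz) (lt_irrefl _)

/-- Since `Φ` is real-valued, its terms can be moved across the inequality even at infinite values
of `ψ`. -/
lemma mem_phiSubdiff_iff_mem_argminSet {X Y : Type*} {Φ : X → Y → ℝ} {ψ : X → EReal}
    {x : X} {y : Y} :
    y ∈ phiSubdiff Φ ψ x ↔ x ∈ argminSet (fun z => ψ z - ((Φ z y : ℝ) : EReal)) := by
  refine forall_congr' fun z => ?_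
  beta_reduce
  induction ψ x <;> induction ψ z
  case coe.coe =>
    norm_cast
    constructor <;> intro <;> linarith
  all_goals simp [-EReal.coe_sub]
  · exact EReal.coe_ne_bot (_ - _)
  · exact EReal.coe_ne_top (_ - _)

/-- Equality in Fenchel-Young: the supremum is attained at `x`. -/
lemma phiConj_eq_of_mem_phiSubdiff {X Y : Type*} {Φ : X → Y → ℝ} {ψ : X → EReal}
    {x : X} {y : Y} (hy : y ∈ phiSubdiff Φ ψ x) {a : ℝ} (ha : ψ x = a) :
    phiConj Φ ψ y = ((Φ x y - a : ℝ) : EReal) := by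
  refine le_antisymm (iSup_le fun z => ?_) ?_
  · have h1 := hy z
    rw [ha] at h1
    induction hz : ψ z with
    | bot => rw [hz] at h1; norm_cast at h1
    | top => simp
    | coe c =>
      rw [hz] at h1
      norm_cast at h1 ⊢
      linarith
  · refine le_trans (le_of_eq ?_) (le_iSup (fun z => ((Φ z y : ℝ) : EReal) - ψ z) x)
    rw [ha]
    norm_cast

lemma phiGap_eq_of_mem_phiSubdiff {X Y : Type*} {Φ : X → Y → ℝ} {ψ : X → EReal}
    {x z : X} {y : Y} (hy : y ∈ phiSubdiff Φ ψ x) {a c : ℝ} (ha : ψ x = a) (hc : ψ z = c) :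
    phiGap Φ ψ z y = ((c + (Φ x y - a) - Φ z y : ℝ) : EReal) := by
  rw [phiGap, phiConj_eq_of_mem_phiSubdiff hy ha, hc]
  norm_cast

lemma epiScale_one_div {n : ℕ} (h : EuclideanSpace ℝ (Fin n) → ℝ) (L : ℝ)
    (x : EuclideanSpace ℝ (Fin n)) : epiScale (1 / L) h x = 1 / L * h (L • x) := by
  simp [epiScale]

lemma sub_anisoCoupling {n : ℕ} (h : EuclideanSpace ℝ (Fin n) → ℝ) (L : ℝ)
    (g : EuclideanSpace ℝ (Fin n) → EReal) (x y : EuclideanSpace ℝ (Fin n)) :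
    g x - ((anisoCoupling h L x y : ℝ) : EReal)
      = g x + ((epiScale (1 / L) h (x - y) : ℝ) : EReal) := by
  rw [anisoCoupling, EReal.coe_neg, sub_eq_add_neg, neg_neg]

lemma gradient_neg_fun {n : ℕ} {f : EuclideanSpace ℝ (Fin n) → ℝ}
    (x : EuclideanSpace ℝ (Fin n)) : gradient (fun x => -f x) x = -gradient f x := by
  simp [gradient, fderiv_fun_neg]

/-- Anisotropic smoothness of `-f` provides `Φ`-subgradients of `f`. -/
lemma AnisoSmooth.mem_phiSubdiff {n : ℕ} {h f : EuclideanSpace ℝ (Fin n) → ℝ} {L : ℝ}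
    (hf : AnisoSmooth h L (fun x => -f x)) (x : EuclideanSpace ℝ (Fin n)) :
    x - L⁻¹ • gradConj h (-gradient f x)
      ∈ phiSubdiff (anisoCoupling h L) (fun x => ((f x : ℝ) : EReal)) x := by
  intro z
  have h1 := hf.descent x z
  rw [gradient_neg_fun] at h1
  beta_reduce
  norm_cast
  simp only [anisoCoupling, sub_sub_cancel, sub_sub_eq_add_sub]
  rw [add_sub_right_comm]
  linarith

lemma coe_mem_phiSubdiff_iff {X Y : Type*} {Φ : X → Y → ℝ} {f : X → ℝ} {x : X} {y : Y} :
    y ∈ phiSubdiff Φ (fun x => ((f x : ℝ) : EReal)) x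
      ↔ ∀ z, f x + (Φ z y - Φ x y) ≤ f z := by
  refine forall_congr' fun z => ?_
  beta_reduce
  norm_cast

/-- A `Φ`-subgradient of `f` at `x` matches the gradients of `-f` and of the reference function. -/
lemma gradient_eq_of_mem_phiSubdiff {n : ℕ} {h f : EuclideanSpace ℝ (Fin n) → ℝ}
    (hh : Differentiable ℝ h) {L : ℝ} (hL : 0 < L) (hf : Differentiable ℝ (fun x => -f x))
    {x y : EuclideanSpace ℝ (Fin n)}
    (hy : y ∈ phiSubdiff (anisoCoupling h L) (fun x => ((f x : ℝ) : EReal)) x) :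
    gradient (fun x => -f x) x = gradient h (L • (x - y)) := by
  have h1 := (hf x).hasGradientAt.hasFDerivAt.sub
    (hasGradientAt_epiScale_sub hh hL x y).hasFDerivAt
  -- The Φ-subgradient inequality says exactly that `x` is a global maximizer here.
  have hmax : IsLocalMax ((fun x => -f x) - fun x => epiScale (1 / L) h (x - y)) x := by
    refine Filter.Eventually.of_forall fun z => ?_
    have := coe_mem_phiSubdiff_iff.1 hy z
    simp only [anisoCoupling] at this
    simp only [Pi.sub_apply]
    linarith
  have h2 := hmax.hasFDerivAt_eq_zero h1
  rw [← map_sub, LinearIsometryEquiv.map_eq_zero_iff, sub_eq_zero] at h2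
  exact h2

/-- The lower bound of strong convexity at a subgradient written as `∇h(w)`. -/
lemma AnisoStronglyConvex.le_of_gradient_mem {n : ℕ} {h : EuclideanSpace ℝ (Fin n) → ℝ}
    (hh : IsFullLegendre h) {η : ℝ} (hη : 0 < η) {ψ : EuclideanSpace ℝ (Fin n) → EReal}
    (hψ : AnisoStronglyConvex h η ψ) {x w : EuclideanSpace ℝ (Fin n)}
    (hw : gradient h w ∈ convexSubdiff ψ x) (z : EuclideanSpace ℝ (Fin n)) :
    ψ x + ((1 / η * (h (η • (z - x) + w) - h w) : ℝ) : EReal) ≤ ψ z := by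
  have h1 := hψ.lower_bound x _ hw (hh.gradient_mem_interior w) z
  rw [hh.gradConj_gradient, epiScale_one_div, epiScale_one_div, smul_add,
    smul_inv_smul₀ hη.ne', ← mul_sub] at h1
  exact h1

/-! ### Lower bounds for the two gaps. -/

/-- The primal gap dominates the suboptimality at the current iterate. -/
lemma primal_gap_ge {n : ℕ} {h : EuclideanSpace ℝ (Fin n) → ℝ} (hh : IsFullLegendre h)
    {L : ℝ} (hL : 0 < L) {f : EuclideanSpace ℝ (Fin n) → ℝ}
    (hf : Differentiable ℝ (fun x => -f x)) {g : EuclideanSpace ℝ (Fin n) → EReal}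
    (hg : Convex ℝ {p : EuclideanSpace ℝ (Fin n) × ℝ | g p.1 ≤ ((p.2 : ℝ) : EReal)})
    {η : ℝ} (hη : 0 < η) (hfs : AnisoStronglyConvex h η (fun x => ((-f x : ℝ) : EReal)))
    {x x' y z : EuclideanSpace ℝ (Fin n)}
    (hyf : y ∈ phiSubdiff (anisoCoupling h L) (fun x => ((f x : ℝ) : EReal)) x)
    (hyg : y ∈ phiSubdiff (anisoCoupling h L) g x')
    {a b c : ℝ} (ha : g x = a) (hb : g x' = b) (hc : g z = c) :
    η / L * ((a - f x) - (c - f z))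
      ≤ a + (anisoCoupling h L x' y - b) - anisoCoupling h L x y := by
  -- For `z = x` the claim is nonnegativity of the gap; the strict inequality below needs `z ≠ x`.
  rcases eq_or_ne z x with rfl | hzx
  · have h1 := hyg z
    rw [hb, hc] at h1
    norm_cast at h1
    obtain rfl : a = c := by rw [ha] at hc; exact_mod_cast hc
    rw [sub_self, mul_zero]
    linarith
  set w := L • (x - y) with hw
  have hsub : gradient h w ∈ convexSubdiff (fun x => ((-f x : ℝ) : EReal)) x := by
    rw [← gradient_eq_of_mem_phiSubdiff hh.differentiable hL hf hyf]
    exact gradient_mem_convexSubdiff hfs.gammaZero.2.2 (hf x).hasGradientAt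
  have hstrong : -f x + 1 / η * (h (η • (z - x) + w) - h w) ≤ -f z := by
    have := hfs.le_of_gradient_mem hh hη hsub z
    exact_mod_cast this
  have hΦ : ∀ d, anisoCoupling h L (x + d) y = -(1 / L * h (L • d + w)) := fun d => by
    rw [anisoCoupling, epiScale_one_div, hw, ← smul_add]
    congr 4
    abel
  have hΦ0 : anisoCoupling h L x y = -(1 / L * h w) := by simpa using hΦ 0
  -- If `L < η`, the slopes `(h(w + s d) - h(w)) / s` with `d = z - x`, strictly increasing in `s`,
  -- would put the smooth upper bound (`s = L`) below the strongly convex lower bound (`s = η`).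
  have hηL : η ≤ L := by
    by_contra! hlt
    have hsm := coe_mem_phiSubdiff_iff.1 hyf (x + (z - x))
    rw [hΦ, hΦ0, add_sub_cancel] at hsm
    have hne : w ≠ η • (z - x) + w := by
      intro he
      rw [right_eq_add, smul_eq_zero] at he
      exact he.elim hη.ne' (sub_ne_zero.2 hzx)
    have hstrict := hh.strictConvex.2 (mem_univ w) (mem_univ _) hne
      (sub_pos.2 ((div_lt_one hη).2 hlt)) (div_pos hL hη) (by ring)
    have e : (1 - L / η) • w + (L / η) • (η • (z - x) + w) = L • (z - x) + w := by
      rw [smul_add, smul_smul (L / η) η, div_mul_cancel₀ _ hη.ne']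
      module
    rw [e] at hstrict
    simp only [smul_eq_mul] at hstrict
    have hstrict' : 1 / L * (h (L • (z - x) + w) - h w)
        < 1 / L * (L / η * (h (η • (z - x) + w) - h w)) :=
      mul_lt_mul_of_pos_left (by linarith) (by positivity)
    have e2 : 1 / L * (L / η * (h (η • (z - x) + w) - h w))
        = 1 / η * (h (η • (z - x) + w) - h w) := by field_simp
    linarith
  have ht1 : η / L ≤ 1 := (div_le_one hL).2 hηL
  have ht0 : 0 < η / L := div_pos hη hL
  -- The step `η / L ≤ 1` stays on the segment, and `L * (η / L) = η` makes the coupling produce the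
  -- term of `hstrong`.
  have h1 := le_of_convex_epigraph hg ha hc ht0.le ht1
  have h2 := (hyg (x + (η / L) • (z - x))).trans h1
  rw [hb, hΦ, smul_smul, mul_div_cancel₀ _ hL.ne'] at h2
  norm_cast at h2
  have h3 := mul_le_mul_of_nonneg_left hstrong ht0.le
  have e3 : η / L * (-f x + 1 / η * (h (η • (z - x) + w) - h w))
      = η / L * (-f x) + 1 / L * (h (η • (z - x) + w) - h w) := by field_simp
  rw [hΦ0]
  linarith

/-- The dual gap dominates the suboptimality at the next iterate. -/
lemma dual_gap_ge {n : ℕ} {h : EuclideanSpace ℝ (Fin n) → ℝ} (hh : IsFullLegendre h)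
    {L : ℝ} (hL : 0 < L) {f : EuclideanSpace ℝ (Fin n) → ℝ}
    (hf : Convex ℝ
      {p : EuclideanSpace ℝ (Fin n) × ℝ | ((-f p.1 : ℝ) : EReal) ≤ ((p.2 : ℝ) : EReal)})
    {g : EuclideanSpace ℝ (Fin n) → EReal} {η : ℝ} (hη : 0 < η)
    (hgs : AnisoStronglyConvex (reflect h) η g)
    {x x' y z : EuclideanSpace ℝ (Fin n)}
    (hyf : y ∈ phiSubdiff (anisoCoupling h L) (fun x => ((f x : ℝ) : EReal)) x)
    (hyg : y ∈ phiSubdiff (anisoCoupling h L) g x')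
    {b c : ℝ} (hb : g x' = b) (hc : g z = c) :
    η / L * ((b - f x') - (c - f z))
      ≤ f x' + (anisoCoupling h L x y - f x) - anisoCoupling h L x' y := by
  set v := L • (x' - y) with hv
  -- Optimality of `x'` gives the subgradient `-∇h(v)`, a gradient of the reflected function.
  have hsub : gradient (reflect h) (-v) ∈ convexSubdiff g x' := by
    rw [gradient_reflect hh.differentiable]
    refine neg_mem_convexSubdiff_of_forall_add_le hgs.gammaZero.2.2 hgs.gammaZero.1.2
      (hasGradientAt_epiScale_sub hh.differentiable hL x' y) hb fun z => ?_
    rw [← sub_anisoCoupling, ← sub_anisoCoupling]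
    exact mem_phiSubdiff_iff_mem_argminSet.1 hyg z
  have hstrong : b + 1 / η * (h (-(η • (z - x')) + v) - h v) ≤ c := by
    have := hgs.le_of_gradient_mem hh.reflect hη hsub z
    rw [hb, hc] at this
    norm_cast at this
    simpa only [reflect, neg_add, neg_neg] using this
  have hΦ : ∀ d, anisoCoupling h L (x' + d) y = -(1 / L * h (L • d + v)) := fun d => by
    rw [anisoCoupling, epiScale_one_div, hv, ← smul_add]
    congr 4
    abel
  have hΦ0 : anisoCoupling h L x' y = -(1 / L * h v) := by simpa using hΦ 0
  set t := η / L with ht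
  have ht0 : 0 < t := div_pos hη hL
  set q := x' + (-t) • (z - x') with hq
  -- `x' = (q + t z) / (1 + t)` lies between `q` and `z` for every `t > 0`, so no comparison of `η`
  -- with `L` is needed.
  have hconv : -((1 + t) * f x') ≤ -f q - t * f z := by
    have h1 := le_of_convex_epigraph (ψ := fun x => ((-f x : ℝ) : EReal)) hf (x := q) (z := z)
      rfl rfl (s := t / (1 + t)) (by positivity) (by rw [div_le_one] <;> linarith)
    have e : q + (t / (1 + t)) • (z - q) = x' := by
      have e1 : z - q = (1 + t) • (z - x') := by rw [hq]; module
      rw [e1, smul_smul, div_mul_cancel₀ _ (by positivity), hq]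
      module
    rw [e] at h1
    norm_cast at h1
    have h2 := mul_le_mul_of_nonneg_left h1 (by positivity : 0 ≤ 1 + t)
    have e2 : (1 + t) * (-f q + t / (1 + t) * (-f z - -f q)) = -f q - t * f z := by
      field_simp
      ring
    linarith
  have h2 := coe_mem_phiSubdiff_iff.1 hyf q
  rw [hq, hΦ, smul_smul, mul_neg, ht, mul_div_cancel₀ _ hL.ne', neg_smul, ← ht, ← hq] at h2
  have h3 := mul_le_mul_of_nonneg_left hstrong ht0.le
  have e3 : t * (b + 1 / η * (h (-(η • (z - x')) + v) - h v))
      = t * b + 1 / L * (h (-(η • (z - x')) + v) - h v) := by rw [ht]; field_simp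
  rw [hΦ0]
  linarith

/-! ### The optimal value of `F` and the PL inequality. -/

lemma dcObjective_coe {X : Type*} {g : X → EReal} {f : X → ℝ} {x : X} {a : ℝ} (ha : g x = a) :
    dcObjective g (fun x => ((f x : ℝ) : EReal)) x = ((a - f x : ℝ) : EReal) := by
  rw [dcObjective, if_neg (by simp [ha]), ha]
  norm_cast

/-- The optimal value of `F` is finite as soon as `F` is bounded below on its domain, and it is
then the greatest lower bound of the real values of `F`. -/
lemma exists_iInf_dcObjective_eq {X : Type*} {g : X → EReal} {f : X → ℝ} (hg : IsProperFun g)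
    {m : ℝ} (hm : ∀ z (c : ℝ), g z = c → m ≤ c - f z) :
    ∃ I : ℝ, (⨅ z, dcObjective g (fun x => ((f x : ℝ) : EReal)) z) = I ∧
      ∀ r : ℝ, (∀ z (c : ℝ), g z = c → r ≤ c - f z) → r ≤ I := by
  have hle : ∀ r : ℝ, (∀ z (c : ℝ), g z = c → r ≤ c - f z) →
      (r : EReal) ≤ ⨅ z, dcObjective g (fun x => ((f x : ℝ) : EReal)) z := by
    refine fun r hr => le_iInf fun z => ?_
    by_cases hz : g z = ⊤
    · simp [dcObjective, hz]
    · obtain ⟨c, hc⟩ := hg.exists_coe_eq hz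
      rw [dcObjective_coe hc]
      exact_mod_cast hr z c hc
  have hbot := ((EReal.bot_lt_coe m).trans_le (hle m hm)).ne'
  have htop : (⨅ z, dcObjective g (fun x => ((f x : ℝ) : EReal)) z) ≠ ⊤ := by
    obtain ⟨z, hz⟩ := hg.1
    obtain ⟨c, hc⟩ := hg.exists_coe_eq hz.ne
    refine ((iInf_le _ z).trans_lt ?_).ne
    rw [dcObjective_coe hc]
    exact EReal.coe_lt_top _
  refine ⟨_, (EReal.coe_toReal htop hbot).symm, fun r hr => ?_⟩
  have := hle r hr
  rw [← EReal.coe_toReal htop hbot] at this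
  exact_mod_cast this

/-- Real-valued form of the PL inequality along one step of the algorithm. -/
lemma exists_iInf_and_gap_ge {n : ℕ} {h : EuclideanSpace ℝ (Fin n) → ℝ} (hh : IsFullLegendre h)
    {L : ℝ} (hL : 0 < L) {f : EuclideanSpace ℝ (Fin n) → ℝ}
    (hf : Differentiable ℝ (fun x => -f x)) {g : EuclideanSpace ℝ (Fin n) → EReal}
    {ηf ηg : ℝ} (hηf : 0 < ηf) (hηg : 0 < ηg)
    (hfs : AnisoStronglyConvex h ηf (fun x => ((-f x : ℝ) : EReal)))
    (hgs : AnisoStronglyConvex (reflect h) ηg g)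
    {x x' y : EuclideanSpace ℝ (Fin n)}
    (hyf : y ∈ phiSubdiff (anisoCoupling h L) (fun x => ((f x : ℝ) : EReal)) x)
    (hyg : y ∈ phiSubdiff (anisoCoupling h L) g x')
    {a b : ℝ} (ha : g x = a) (hb : g x' = b) :
    ∃ I : ℝ, (⨅ z, dcObjective g (fun x => ((f x : ℝ) : EReal)) z) = I ∧
      ηf / L * ((a - f x) - I)
        ≤ a + (anisoCoupling h L x' y - b) - anisoCoupling h L x y ∧
      ηg / L * ((b - f x') - I)
        ≤ f x' + (anisoCoupling h L x y - f x) - anisoCoupling h L x' y := by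
  have hμf : 0 < ηf / L := div_pos hηf hL
  have hμg : 0 < ηg / L := div_pos hηg hL
  -- In this form a gap estimate is a lower bound on `F` independent of `z`: the primal one makes
  -- `inf F` finite, and both then pass to the infimum.
  have hdiv : ∀ {μ G A r : ℝ}, 0 < μ → (μ * (A - r) ≤ G ↔ A - G / μ ≤ r) := by
    intro μ G A r hμ
    rw [mul_comm, ← le_div_iff₀ hμ, sub_le_comm]
  have hlow := fun z c (hc : g z = (c : ℝ)) =>
    (hdiv hμf).1 (primal_gap_ge hh hL hf hgs.gammaZero.2.2 hηf hfs hyf hyg ha hb hc)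
  obtain ⟨I, hI, hglb⟩ := exists_iInf_dcObjective_eq hgs.gammaZero.1 hlow
  exact ⟨I, hI, (hdiv hμf).2 (hglb _ hlow), (hdiv hμg).2 (hglb _ fun z c hc =>
    (hdiv hμg).1 (dual_gap_ge hh hL hfs.gammaZero.2.2 hηg hgs hyf hyg hb hc))⟩

theorem mainTheorem6 {n : ℕ}
    (h : EuclideanSpace ℝ (Fin n) → ℝ) (hh : IsFullLegendre h)
    (L : ℝ) (hL : 0 < L)
    (f : EuclideanSpace ℝ (Fin n) → ℝ) (hf : AnisoSmooth h L (fun x => -f x))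
    (g : EuclideanSpace ℝ (Fin n) → EReal) (hg : IsProperFun g) (hg_lsc : LowerSemicontinuous g)
    (hg_lb : ∀ y, IsLevelBounded (fun x => g x + ((epiScale (1 / L) h (x - y) : ℝ) : EReal))) :
    -- explicit forms of the primal and dual gaps
    (∀ xbar ybar xplus : EuclideanSpace ℝ (Fin n),
      ybar = xbar - L⁻¹ • gradConj h (-gradient f xbar) →
      xplus ∈ argminSet (fun x => g x + ((epiScale (1 / L) h (x - ybar) : ℝ) : EReal)) →
        phiGap (anisoCoupling h L) g xbar ybar
            = g xbar - (⨅ x, (g x + ((epiScale (1 / L) h (x - ybar) : ℝ) : EReal)))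
              + ((epiScale (1 / L) h (L⁻¹ • gradConj h (-gradient f xbar)) : ℝ) : EReal) ∧
        phiGap (anisoCoupling h L) (fun x => ((f x : ℝ) : EReal)) xplus ybar
            = ((-f xbar + f xplus + epiScale (1 / L) h (xplus - ybar)
              - epiScale (1 / L) h (L⁻¹ • gradConj h (-gradient f xbar)) : ℝ) : EReal)) ∧
    -- the PL inequality and the resulting q-linear rate
    (∀ ηf ηg : ℝ, 0 < ηf → 0 < ηg →
      AnisoStronglyConvex h ηf (fun x => ((-f x : ℝ) : EReal)) →
      AnisoStronglyConvex (reflect h) ηg g →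
        PhiDCAPL (anisoCoupling h L) g (fun x => ((f x : ℝ) : EReal)) (ηf / L) (ηg / L) ∧
        (1 - ηf / L) / (1 + ηg / L) < 1 ∧
        ∀ x y : ℕ → EuclideanSpace ℝ (Fin n),
          IsPhiDCA (anisoCoupling h L) g (fun x => ((f x : ℝ) : EReal)) x y →
          ∀ k, dcObjective g (fun x => ((f x : ℝ) : EReal)) (x k) < ⊤ →
            dcObjective g (fun x => ((f x : ℝ) : EReal)) (x (k + 1))
                - (⨅ z, dcObjective g (fun x => ((f x : ℝ) : EReal)) z)
              ≤ (((1 - ηf / L) / (1 + ηg / L) : ℝ) : EReal)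
                * (dcObjective g (fun x => ((f x : ℝ) : EReal)) (x k)
                  - (⨅ z, dcObjective g (fun x => ((f x : ℝ) : EReal)) z))) := by
  refine ⟨?_, ?_⟩
  · rintro xbar ybar xplus rfl hplus
    set ybar := xbar - L⁻¹ • gradConj h (-gradient f xbar) with hybar
    have hw : xbar - ybar = L⁻¹ • gradConj h (-gradient f xbar) := by rw [hybar, sub_sub_cancel]
    have hyf : ybar ∈ phiSubdiff (anisoCoupling h L) (fun x => ((f x : ℝ) : EReal)) xbar :=
      hf.mem_phiSubdiff xbar
    have hyg : ybar ∈ phiSubdiff (anisoCoupling h L) g xplus := by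
      rw [mem_phiSubdiff_iff_mem_argminSet]
      simp only [sub_anisoCoupling]
      exact hplus
    obtain ⟨b, hb⟩ := exists_coe_eq_of_mem_phiSubdiff hg hyg
    rw [← hw]
    constructor
    · have hinf : (⨅ x, (g x + ((epiScale (1 / L) h (x - ybar) : ℝ) : EReal)))
          = ((b + epiScale (1 / L) h (xplus - ybar) : ℝ) : EReal) := by
        rw [EReal.coe_add, ← hb]
        exact le_antisymm (iInf_le _ xplus) (le_iInf hplus)
      rw [hinf]
      by_cases htop : g xbar = ⊤
      · rw [phiGap, phiConj_eq_of_mem_phiSubdiff hyg hb, htop]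
        simp only [EReal.top_add_coe, EReal.top_sub_coe]
      · obtain ⟨a, ha⟩ := hg.exists_coe_eq htop
        rw [phiGap_eq_of_mem_phiSubdiff hyg hb ha, ha]
        simp only [anisoCoupling]
        norm_cast
        ring
    · rw [phiGap_eq_of_mem_phiSubdiff hyf (z := xplus) rfl rfl]
      simp only [anisoCoupling]
      norm_cast
      ring
  · intro ηf ηg hηf hηg hfs hgs
    have hμf : 0 < ηf / L := div_pos hηf hL
    have hμg : 0 < ηg / L := div_pos hηg hL
    have hfd : Differentiable ℝ (fun x => -f x) := hf.contDiff.differentiable one_ne_zero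
    have hdom : ∀ {x}, dcObjective g (fun x => ((f x : ℝ) : EReal)) x < ⊤ → ∃ a : ℝ, g x = a := by
      intro x hx
      refine hg.exists_coe_eq fun htop => ?_
      simp [dcObjective, htop] at hx
    refine ⟨⟨add_pos hμf hμg, ?_⟩, ?_, ?_⟩
    · intro xbar hxbar ybar hyf xplus hplus
      have hyg := mem_phiSubdiff_iff_mem_argminSet.2 hplus
      obtain ⟨a, ha⟩ := hdom hxbar
      obtain ⟨b, hb⟩ := exists_coe_eq_of_mem_phiSubdiff hg hyg
      obtain ⟨I, hI, h1, h2⟩ :=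
        exists_iInf_and_gap_ge hh hL hfd hηf hηg hfs hgs hyf hyg ha hb
      rw [hI, dcObjective_coe ha, dcObjective_coe hb, phiGap_eq_of_mem_phiSubdiff hyg hb ha,
        phiGap_eq_of_mem_phiSubdiff hyf (z := xplus) rfl rfl]
      exact_mod_cast add_le_add h1 h2
    · rw [div_lt_one (by positivity)]
      linarith
    · intro x y hxy k hk
      obtain ⟨hyf, hyg⟩ := hxy k
      obtain ⟨a, ha⟩ := hdom hk
      obtain ⟨b, hb⟩ := exists_coe_eq_of_mem_phiSubdiff hg hyg
      obtain ⟨I, hI, h1, h2⟩ :=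
        exists_iInf_and_gap_ge hh hL hfd hηf hηg hfs hgs hyf hyg ha hb
      rw [hI, dcObjective_coe ha, dcObjective_coe hb]
      norm_cast
      rw [div_mul_eq_mul_div, le_div_iff₀ (by positivity)]
      -- In the sum of `h1` and `h2` the couplings cancel and the right side becomes `F(x k) - F(x
      -- (k + 1))`.
      linarith
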